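/- A ternary $[n,k,d]$ code is a $k$-dimensional subspace of $\mathbb F_3^n$ whose minimum nonzero Hamming weight $\mathrm{wt}$ is $d$. Two ternary codes of length $n$ are equivalent if one is obtained from the other by permuting the coordinates and changing the signs of certain coordinates. For a code $C\subseteq\mathbb F_3^{12}$ write its codewords as $c=(x_1,\dots,x_{10},y_1,y_2)=(x,y)$, let $Pun(C)\subseteq\mathbb F_3^{10}$ be the code obtained by deleting the last two coordinates, and consider the conditions, for all $c=(x,y)\in C$: (C1) $\mathrm{wt}(x)\equiv y_1y_2 \pmod 3$; (C2) if $c\neq 0$, then $\mathrm{wt}(x)\ge 3$; (C3) if $\mathrm{wt}(x)=3$, then $(y_1,y_2)\neq(0,0)$. Two codes of length $12$ are SZ-equivalent if one is obtained from the other by a map $$(x_1,\dots,x_{10},y_1,y_2)\mapsto((-1)^{\alpha_1}x_{\sigma(1)},\dots,(-1)^{\alpha_{10}}x_{\sigma(10)},(-1)^{\beta}y_{\tau(1)},(-1)^{\beta}y_{\tau(2)})$$ with $\alpha_1,\dots,\alpha_{10},\beta\in\{0,1\}$, $\sigma\in S_{10}$, $\tau\in S_2$. Let $C_{10,5}$,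 $C_{10,4,60}$, $C_{10,4,132}$ be the codes with generator matrices $(I_5\mid A)$, where the rows of $A$ are, respectively, $12210,\,01221,\,10122,\,21012,\,22101$; $00111,\,01011,\,10101,\,11001,\,12210$; $00111,\,01011,\,10101,\,11001,\,11111$. Let $\mathcal C_{12,1}$, $\mathcal C_{12,2}$, $\mathcal C_{12,3}$ be the codes of length $12$ whose generator matrices are obtained from these three matrices by appending to the five rows, respectively, the pairs $12,\,12,\,12,\,12,\,12$; $11,\,22,\,22,\,11,\,12$; $11,\,22,\,22,\,11,\,00$. Lemma. Up to SZ-equivalence, there are exactly three ternary $[12,5,6]$ codes satisfying (C1)–(C3), namely $\mathcal C_{12,1},\mathcal C_{12,2},\mathcal C_{12,3}$: these are $[12,5,6]$ codes satisfying (C1)–(C3), they are pairwise not SZ-equivalent, and every ternary $[12,5,6]$ code satisfying (C1)–(C3) is SZ-equivalent to one of them. They arise from $C_{10,5}$, which is the unique ternary $[10,5,5]$ code up to equivalence, and from the two inequivalent $[10,5,4]$ codes $C_{10,4,60}$ and $C_{10,4,132}$: we have $Pun(\mathcal C_{12,1})=C_{10,5}$, $Pun(\mathcal C_{12,2})=C_{10,4,60}$,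 $Pun(\mathcal C_{12,3})=C_{10,4,132}$, and a ternary $[12,5,6]$ code $C$ satisfying (C1)–(C3) is SZ-equivalent to $\mathcal C_{12,i}$ if and only if $Pun(C)$ is equivalent to $Pun(\mathcal C_{12,i})$ $(i=1,2,3)$. -/

import Mathlib

/-- The ambient space `𝔽₃ⁿ`. -/
abbrev TernaryWord (n : ℕ) : Type := Fin n → ZMod 3

/-- A ternary linear code of length `n`: a vector subspace of `𝔽₃ⁿ`. -/
abbrev TernaryCode (n : ℕ) : Type := Submodule (ZMod 3) (TernaryWord n)

/-- `C` is a ternary `[n, k, d]` code: it has dimension `k` and minimum (nonzero) weight `d`. -/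
def IsTernaryCode (n k d : ℕ) (C : TernaryCode n) : Prop :=
  Module.finrank (ZMod 3) C = k ∧ IsLeast {w : ℕ | ∃ c ∈ C, c ≠ 0 ∧ hammingNorm c = w} d

/-- The usual equivalence of ternary codes: one is obtained from the other by permuting the
coordinates and changing the signs of certain coordinates. -/
def CodeEquiv {n : ℕ} (C C' : TernaryCode n) : Prop :=
  ∃ (σ : Equiv.Perm (Fin n)) (α : Fin n → Fin 2),
    (C' : Set (TernaryWord n)) =
      (fun (c : TernaryWord n) (i : Fin n) => (-1) ^ (α i : ℕ) * c (σ i)) '' C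

/-- The part `(x₁, …, x₁₀)` of a word `(x₁, …, x₁₀, y₁, y₂)`. -/
def xPart (c : TernaryWord (10 + 2)) : TernaryWord 10 := fun i => c (Fin.castAdd 2 i)

/-- The part `(y₁, y₂)` of a word `(x₁, …, x₁₀, y₁, y₂)`. -/
def yPart (c : TernaryWord (10 + 2)) : TernaryWord 2 := fun j => c (Fin.natAdd 10 j)

/-- The code punctured at the last two coordinates. -/
def puncture (C : TernaryCode (10 + 2)) : TernaryCode 10 :=
  C.map (LinearMap.funLeft (ZMod 3) (ZMod 3) (Fin.castAdd 2 : Fin 10 → Fin (10 + 2)))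

/-- The three conditions on the codewords `(x₁, …, x₁₀, y₁, y₂)` of a code of length `12`:
`wt (x₁, …, x₁₀) ≡ y₁ y₂ (mod 3)`; `wt (x₁, …, x₁₀) ≥ 3` for nonzero codewords; and
`(y₁, y₂) ≠ (0, 0)` if `wt (x₁, …, x₁₀) = 3`. -/
structure SZConditions (C : TernaryCode (10 + 2)) : Prop where
  weight_mod : ∀ c ∈ C, (hammingNorm (xPart c) : ZMod 3) = yPart c 0 * yPart c 1
  three_le : ∀ c ∈ C, c ≠ 0 → 3 ≤ hammingNorm (xPart c)
  yPart_ne : ∀ c ∈ C, hammingNorm (xPart c) = 3 → yPart c ≠ 0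

/-- The map `(x, y) ↦ ((-1)^{α₁} x_{σ(1)}, …, (-1)^{α₁₀} x_{σ(10)}, (-1)^β y_{τ(1)},
(-1)^β y_{τ(2)})`. -/
def szMap (σ : Equiv.Perm (Fin 10)) (α : Fin 10 → Fin 2) (τ : Equiv.Perm (Fin 2)) (β : Fin 2)
    (c : TernaryWord (10 + 2)) : TernaryWord (10 + 2) :=
  Fin.append (fun i => (-1) ^ (α i : ℕ) * xPart c (σ i))
    (fun j => (-1) ^ (β : ℕ) * yPart c (τ j))

/-- SZ-equivalence of codes of length `12`. -/
def SZEquiv (C C' : TernaryCode (10 + 2)) : Prop :=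
  ∃ (σ : Equiv.Perm (Fin 10)) (α : Fin 10 → Fin 2) (τ : Equiv.Perm (Fin 2)) (β : Fin 2),
    (C' : Set (TernaryWord (10 + 2))) = szMap σ α τ β '' C

/-- The code with generator matrix `G`, i.e. the span of the rows of `G`. -/
def codeOf {k n : ℕ} (G : Matrix (Fin k) (Fin n) (ZMod 3)) : TernaryCode n :=
  Submodule.span (ZMod 3) (Set.range G.row)

/-- The juxtaposition `(M | N)` of two matrices with five rows. -/
def juxtapose {m n : ℕ} (M : Matrix (Fin 5) (Fin m) (ZMod 3)) (N : Matrix (Fin 5) (Fin n) (ZMod 3)) :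
    Matrix (Fin 5) (Fin (m + n)) (ZMod 3) :=
  Matrix.of fun i => Fin.append (M i) (N i)

/-- The generator matrix `(I₅ | A)` of the `[10, 5, 5]` code `C_{10,5}`. -/
def gen10 : Matrix (Fin 5) (Fin (5 + 5)) (ZMod 3) :=
  juxtapose 1 !![1, 2, 2, 1, 0; 0, 1, 2, 2, 1; 1, 0, 1, 2, 2; 2, 1, 0, 1, 2; 2, 2, 1, 0, 1]

/-- The generator matrix `(I₅ | A)` of the `[10, 5, 4]` code `C_{10,4,60}`. -/
def gen60 : Matrix (Fin 5) (Fin (5 + 5)) (ZMod 3) :=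
  juxtapose 1 !![0, 0, 1, 1, 1; 0, 1, 0, 1, 1; 1, 0, 1, 0, 1; 1, 1, 0, 0, 1; 1, 2, 2, 1, 0]

/-- The generator matrix `(I₅ | A)` of the `[10, 5, 4]` code `C_{10,4,132}`. -/
def gen132 : Matrix (Fin 5) (Fin (5 + 5)) (ZMod 3) :=
  juxtapose 1 !![0, 0, 1, 1, 1; 0, 1, 0, 1, 1; 1, 0, 1, 0, 1; 1, 1, 0, 0, 1; 1, 1, 1, 1, 1]

/-- The codes `C_{10,5}`, `C_{10,4,60}`, `C_{10,4,132}`. -/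
def code10 : Fin 3 → TernaryCode 10 :=
  ![codeOf gen10, codeOf gen60, codeOf gen132]

/-- The codes of length `12` with generator matrices `(G | aᵀ bᵀ)`, where `G` generates
`C_{10,5}`, `C_{10,4,60}`, `C_{10,4,132}`. -/
def code12 : Fin 3 → TernaryCode (10 + 2) :=
  ![codeOf (juxtapose gen10 !![1, 2; 1, 2; 1, 2; 1, 2; 1, 2]),
    codeOf (juxtapose gen60 !![1, 1; 2, 2; 2, 2; 1, 1; 1, 2]),
    codeOf (juxtapose gen132 !![1, 1; 2, 2; 2, 2; 1, 1; 0, 0])]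

/-!
A code satisfying (C1)-(C3) is totally isotropic for the quadratic form `wt x - y₁ y₂`. Its words
with `y₂ = 0` have weight `wt x` divisible by three and at least four, so they puncture to a code
of minimum weight six. This code has dimension four, because there is no ternary `[10, 5, 6]` code,
and isotropy recovers the whole code from it and the `x`-part `w` of one further word with
`y₂ = 1`.

The `[10, 4, 6]` code is unique and can be taken negacyclic. Its symmetries act on the cosets of
the words `w`, and those which yield minimum weight four form three classes. The three codes of the
theorem are inequivalent, since their punctured codes are, so each represents one of these classes.

For the uniqueness of `[10, 5, 5]` and `[10, 4, 6]` codes, write the code as `(I | A)`. A row of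
`A` has at most one zero, and the supports of two rows differ; permuting and rescaling gives a
normal form with few candidates for each row, which leaves a small search.
-/

open Matrix

section Monomial

variable {ι R : Type*} [CommRing R]

/-- The monomial map `c ↦ (s i • c (σ i))ᵢ`: a permutation of the coordinates followed by a
rescaling with units. -/
def monomialEquiv (σ : Equiv.Perm ι) (s : ι → Rˣ) : (ι → R) ≃ₗ[R] (ι → R) :=
  (LinearEquiv.funCongrLeft R R σ).trans
    (LinearEquiv.piCongrRight fun i => LinearEquiv.smulOfUnit (s i))

@[simp] lemma monomialEquiv_apply (σ : Equiv.Perm ι) (s : ι → Rˣ) (c : ι → R) (i : ι) :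
    monomialEquiv σ s c i = s i * c (σ i) := rfl

lemma monomialEquiv_trans (σ τ : Equiv.Perm ι) (s t : ι → Rˣ) :
    (monomialEquiv σ s).trans (monomialEquiv τ t) =
      monomialEquiv (τ.trans σ) fun i => t i * s (τ i) := by
  ext c i
  simp [mul_assoc]

lemma monomialEquiv_symm (σ : Equiv.Perm ι) (s : ι → Rˣ) :
    (monomialEquiv σ s).symm = monomialEquiv σ.symm fun i => (s (σ.symm i))⁻¹ := by
  refine LinearEquiv.ext fun c => (LinearEquiv.symm_apply_eq _).2 ?_
  ext i
  simp

lemma hammingNorm_monomialEquiv [Fintype ι] [DecidableEq R] (σ : Equiv.Perm ι) (s : ι → Rˣ)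
    (c : ι → R) : hammingNorm (monomialEquiv σ s c) = hammingNorm c := by
  simp only [hammingNorm, monomialEquiv_apply, ne_eq, Units.mul_right_eq_zero,
    Finset.card_filter]
  exact Equiv.sum_comp σ fun i => if ¬c i = 0 then 1 else 0

lemma units_mul_self (s : (ZMod 3)ˣ) : (s * s : ZMod 3) = 1 := by
  revert s; decide

lemma monomialEquiv_dotProduct [Fintype ι] (σ : Equiv.Perm ι) (s : ι → (ZMod 3)ˣ)
    (c d : ι → ZMod 3) : monomialEquiv σ s c ⬝ᵥ monomialEquiv σ s d = c ⬝ᵥ d := by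
  simp only [dotProduct, monomialEquiv_apply, mul_mul_mul_comm, units_mul_self, one_mul]
  exact Equiv.sum_comp σ fun i => c i * d i

lemma hammingNorm_eq_dotProduct [Fintype ι] (x : ι → ZMod 3) :
    (hammingNorm x : ZMod 3) = x ⬝ᵥ x := by
  have coordinate : ∀ a : ZMod 3, ((if a ≠ 0 then 1 else 0 : ℕ) : ZMod 3) = a * a := by decide
  rw [hammingNorm, Finset.card_filter, Nat.cast_sum]
  exact Finset.sum_congr rfl fun i _ => coordinate (x i)

end Monomial

section CodeEquiv

variable {n : ℕ} {C C' C'' : TernaryCode n}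

lemma exists_sign_eq_unit (s : (ZMod 3)ˣ) : ∃ a : Fin 2, (-1 : ZMod 3) ^ (a : ℕ) = s := by
  revert s; decide

lemma codeEquiv_iff : CodeEquiv C C' ↔
    ∃ (σ : Equiv.Perm (Fin n)) (s : Fin n → (ZMod 3)ˣ),
      C.map (monomialEquiv σ s).toLinearMap = C' := by
  constructor
  · rintro ⟨σ, α, h⟩
    refine ⟨σ, fun i => (-1) ^ (α i : ℕ), SetLike.coe_injective ?_⟩
    rw [h, Submodule.map_coe]
    refine congrArg (· '' (C : Set (TernaryWord n))) ?_
    ext c i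
    simp
  · rintro ⟨σ, s, rfl⟩
    choose α hα using fun i => exists_sign_eq_unit (s i)
    exact ⟨σ, α, by simp only [hα]; rfl⟩

lemma CodeEquiv.symm (h : CodeEquiv C C') : CodeEquiv C' C := by
  obtain ⟨σ, s, rfl⟩ := codeEquiv_iff.1 h
  refine codeEquiv_iff.2 ⟨σ.symm, fun i => (s (σ.symm i))⁻¹, ?_⟩
  rw [← monomialEquiv_symm, ← Submodule.map_comp, LinearEquiv.symm_comp, Submodule.map_id]

lemma CodeEquiv.trans (h : CodeEquiv C C') (h' : CodeEquiv C' C'') : CodeEquiv C C'' := by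
  obtain ⟨σ, s, rfl⟩ := codeEquiv_iff.1 h
  obtain ⟨τ, t, rfl⟩ := codeEquiv_iff.1 h'
  refine codeEquiv_iff.2 ⟨τ.trans σ, fun i => t i * s (τ i), ?_⟩
  rw [← monomialEquiv_trans, ← Submodule.map_comp]
  rfl

lemma CodeEquiv.exists_mem_hammingNorm_eq (h : CodeEquiv C C') {c : TernaryWord n} (hc : c ∈ C) :
    ∃ c' ∈ C', hammingNorm c' = hammingNorm c := by
  obtain ⟨σ, s, rfl⟩ := codeEquiv_iff.1 h
  exact ⟨_, Submodule.mem_map_of_mem hc, hammingNorm_monomialEquiv σ s c⟩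

/-- All nonzero words of `C` have weight at least `d`. -/
def MinWeightGE (d : ℕ) (C : TernaryCode n) : Prop :=
  ∀ c ∈ C, c ≠ 0 → d ≤ hammingNorm c

lemma MinWeightGE.of_codeEquiv {d : ℕ} (hC : MinWeightGE d C) (h : CodeEquiv C C') :
    MinWeightGE d C' := by
  intro c hc hc0
  obtain ⟨c', hc', hcc'⟩ := h.symm.exists_mem_hammingNorm_eq hc
  rw [← hcc']
  exact hC c' hc' (hammingNorm_ne_zero_iff.1 (hcc'.trans_ne (hammingNorm_ne_zero_iff.2 hc0)))

lemma IsTernaryCode.minWeightGE {k d : ℕ} (h : IsTernaryCode n k d C) : MinWeightGE d C :=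
  fun c hc hc0 => h.2.2 ⟨c, hc, hc0, rfl⟩

lemma IsTernaryCode.eq_of_codeEquiv {k d d' : ℕ} (hC : IsTernaryCode n k d C)
    (hC' : IsTernaryCode n k d' C') (h : CodeEquiv C C') : d = d' := by
  obtain ⟨c, hc, hc0, rfl⟩ := hC.2.1
  obtain ⟨c', hc', hc'0, rfl⟩ := hC'.2.1
  exact le_antisymm ((hC.minWeightGE.of_codeEquiv h) c' hc' hc'0)
    ((hC'.minWeightGE.of_codeEquiv h.symm) c hc hc0)

end CodeEquiv

section Append

variable {k m n : ℕ} {α : Type*}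

lemma append_inj {u u' : Fin m → α} {v v' : Fin n → α} :
    Fin.append u v = Fin.append u' v' ↔ u = u' ∧ v = v' :=
  (Fin.appendEquiv m n).injective.eq_iff (a := (u, v)) (b := (u', v')) |>.trans Prod.mk_inj

lemma append_add_append [Add α] {u u' : Fin m → α} {v v' : Fin n → α} :
    Fin.append u v + Fin.append u' v' = Fin.append (u + u') (v + v') := by
  ext j
  refine Fin.addCases (fun j => ?_) (fun j => ?_) j <;> simp

lemma append_eq_zero [Zero α] {u : Fin m → α} {v : Fin n → α} :
    Fin.append u v = 0 ↔ u = 0 ∧ v = 0 := by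
  rw [← append_inj, ← Fin.append_castAdd_natAdd (f := (0 : Fin (m + n) → α))]
  rfl

lemma hammingNorm_append [Zero α] [DecidableEq α] (u : Fin m → α) (v : Fin n → α) :
    hammingNorm (Fin.append u v) = hammingNorm u + hammingNorm v := by
  simp only [hammingNorm, Finset.card_filter, Fin.sum_univ_add, Fin.append_left, Fin.append_right]

lemma vecMul_of_append [NonUnitalNonAssocSemiring α] (u : Fin k → α)
    (M : Matrix (Fin k) (Fin m) α) (N : Matrix (Fin k) (Fin n) α) :
    u ᵥ* Matrix.of (fun i => Fin.append (M i) (N i)) = Fin.append (u ᵥ* M) (u ᵥ* N) := by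
  ext j
  refine Fin.addCases (fun j => ?_) (fun j => ?_) j <;> simp [vecMul, dotProduct]

end Append

section GeneratorMatrix

variable {k m n : ℕ}

lemma mem_codeOf {G : Matrix (Fin k) (Fin n) (ZMod 3)} {x : TernaryWord n} :
    x ∈ codeOf G ↔ ∃ u, u ᵥ* G = x := by
  rw [codeOf, ← range_vecMulLinear]
  rfl

lemma finrank_codeOf {G : Matrix (Fin k) (Fin n) (ZMod 3)} (hG : Function.Injective (· ᵥ* G)) :
    Module.finrank (ZMod 3) (codeOf G) = k := by
  rw [codeOf, ← range_vecMulLinear]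
  exact (LinearMap.finrank_range_of_inj (f := G.vecMulLinear) hG).trans (Module.finrank_fin_fun _)

/-- The systematic generator matrix `(I | A)` with redundancy part `A`. -/
def sysMatrix (A : Matrix (Fin k) (Fin m) (ZMod 3)) : Matrix (Fin k) (Fin (k + m)) (ZMod 3) :=
  Matrix.of fun i => Fin.append ((1 : Matrix (Fin k) (Fin k) (ZMod 3)) i) (A i)

/-- The systematic code with generator matrix `(I | A)`. -/
def sysCode (A : Matrix (Fin k) (Fin m) (ZMod 3)) : TernaryCode (k + m) :=
  codeOf (sysMatrix A)

variable {A : Matrix (Fin k) (Fin m) (ZMod 3)}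

lemma mem_sysCode {x : TernaryWord (k + m)} :
    x ∈ sysCode A ↔ ∃ u, Fin.append u (u ᵥ* A) = x := by
  simp only [sysCode, sysMatrix, mem_codeOf, vecMul_of_append, vecMul_one]

lemma append_mem_sysCode {u : Fin k → ZMod 3} {v : Fin m → ZMod 3} :
    Fin.append u v ∈ sysCode A ↔ v = u ᵥ* A := by
  simp only [mem_sysCode, append_inj]
  constructor
  · rintro ⟨_, rfl, h⟩
    exact h.symm
  · rintro rfl
    exact ⟨u, rfl, rfl⟩

lemma mem_sysCode_iff {x : TernaryWord (k + m)} : x ∈ sysCode A ↔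
    (fun j => x (Fin.natAdd k j)) = (fun i => x (Fin.castAdd m i)) ᵥ* A := by
  rw [← append_mem_sysCode, Fin.append_castAdd_natAdd]

instance : DecidablePred (· ∈ sysCode A) := fun _ => decidable_of_iff _ mem_sysCode_iff.symm

lemma exists_append_zero_sub_mem_sysCode (A : Matrix (Fin k) (Fin m) (ZMod 3))
    (x : TernaryWord (k + m)) : ∃ v, x - Fin.append 0 v ∈ sysCode A := by
  let u : TernaryWord k := fun i => x (Fin.castAdd m i)
  let v : TernaryWord m := fun j => x (Fin.natAdd k j)
  refine ⟨v - u ᵥ* A, mem_sysCode.2 ⟨u, eq_sub_of_add_eq ?_⟩⟩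
  rw [append_add_append, add_zero, add_sub_cancel, Fin.append_castAdd_natAdd]

lemma sysMatrix_mulVec_append_zero (A : Matrix (Fin k) (Fin m) (ZMod 3)) (v : TernaryWord m) :
    sysMatrix A *ᵥ Fin.append 0 v = A *ᵥ v := by
  ext i
  simp [sysMatrix, mulVec, dotProduct, Fin.sum_univ_add]

lemma finrank_sysCode (A : Matrix (Fin k) (Fin m) (ZMod 3)) :
    Module.finrank (ZMod 3) (sysCode A) = k := by
  refine finrank_codeOf fun u u' h => ?_
  simp only [sysMatrix, vecMul_of_append, vecMul_one, append_inj] at h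
  exact h.1

lemma minWeightGE_sysCode {d : ℕ} : MinWeightGE d (sysCode A) ↔
    ∀ u, u ≠ 0 → d ≤ hammingNorm u + hammingNorm (u ᵥ* A) := by
  simp only [MinWeightGE, mem_sysCode, forall_exists_index, forall_apply_eq_imp_iff,
    hammingNorm_append]
  refine forall_congr' fun u => imp_congr_left (not_congr (append_eq_zero.trans ?_))
  exact ⟨And.left, fun h => ⟨h, by rw [h, zero_vecMul]⟩⟩

end GeneratorMatrix

section SystematicForm

lemma exists_informationSet {K ι : Type*} [Field K] [Finite ι] {k : ℕ}
    {C : Submodule K (ι → K)} (hC : Module.finrank K C = k) :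
    ∃ (q : Fin k → ι) (e : C ≃ₗ[K] (Fin k → K)), ∀ c i, e c i = (c : ι → K) (q i) := by
  let φ : ι → Module.Dual K C := fun j => LinearMap.proj j ∘ₗ C.subtype
  have ext_φ : ∀ x : C, (∀ j, φ j x = 0) → x = 0 := fun x hx => Subtype.ext (funext hx)
  have span_φ : Submodule.span K (Set.range φ) = ⊤ := by
    refine eq_top_iff.2 fun f _ => mem_span_of_iInf_ker_le_ker fun x hx => ?_
    rw [ext_φ x fun j => (Submodule.mem_iInf _).1 hx j]
    exact zero_mem _
  have finrank_φ : Module.finrank K (Submodule.span K (Set.range φ)) = k := by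
    rw [span_φ, finrank_top, Subspace.dual_finrank_eq, hC]
  subst finrank_φ
  obtain ⟨f, hf, span_f, -⟩ := Submodule.exists_fun_fin_finrank_span_eq K (Set.range φ)
  choose q hq using hf
  let T := LinearMap.pi fun i => φ (q i)
  have hT : Function.Injective T := by
    refine (injective_iff_map_eq_zero T).2 fun x hx => ext_φ x fun j => ?_
    have hfx : Submodule.span K (Set.range f) ≤ LinearMap.ker (Module.Dual.eval K C x) := by
      rw [Submodule.span_le]
      rintro _ ⟨i, rfl⟩
      rw [← hq]
      exact congrFun hx i
    exact hfx (by rw [span_f]; exact Submodule.subset_span ⟨j, rfl⟩)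
  exact ⟨q, LinearEquiv.ofInjectiveOfFinrankEq T hT (by rw [hC, Module.finrank_fin_fun]),
    fun c i => rfl⟩

variable {k m : ℕ}

lemma codeEquiv_of_forall_monomialEquiv_mem {n : ℕ} {C D : TernaryCode n}
    (σ : Equiv.Perm (Fin n)) (s : Fin n → (ZMod 3)ˣ) (h : ∀ c ∈ C, monomialEquiv σ s c ∈ D)
    (hCD : Module.finrank (ZMod 3) C = Module.finrank (ZMod 3) D) : CodeEquiv C D := by
  refine codeEquiv_iff.2
    ⟨σ, s, Submodule.eq_of_le_of_finrank_eq (Submodule.map_le_iff_le_comap.2 h) ?_⟩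
  rw [LinearEquiv.finrank_map_eq, hCD]

theorem exists_codeEquiv_sysCode {C : TernaryCode (k + m)}
    (hC : Module.finrank (ZMod 3) C = k) :
    ∃ A : Matrix (Fin k) (Fin m) (ZMod 3), CodeEquiv C (sysCode A) := by
  obtain ⟨q, e, he⟩ := exists_informationSet hC
  have hq : Function.Injective q := fun i i' h => by
    have hsingle := he (e.symm (Pi.single i 1))
    rw [e.apply_symm_apply] at hsingle
    by_contra hne
    simpa [← h, ← hsingle, Ne.symm hne] using hsingle i'
  obtain ⟨σ, hσ⟩ := Equiv.Perm.exists_extending_pair (Fin.castAdd m : Fin k → _) q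
    (Fin.castAdd_injective k m) hq
  let L : (Fin k → ZMod 3) →ₗ[ZMod 3] (Fin m → ZMod 3) :=
    LinearMap.funLeft _ _ (σ ∘ Fin.natAdd k) ∘ₗ C.subtype ∘ₗ e.symm.toLinearMap
  refine ⟨L.toMatrix'ᵀ,
    codeEquiv_of_forall_monomialEquiv_mem σ 1 (fun c hc => ?_) (by rw [hC, finrank_sysCode])⟩
  refine mem_sysCode.2 ⟨e ⟨c, hc⟩, funext (Fin.addCases (fun i => ?_) fun j => ?_)⟩
  · simp [he, hσ]
  · simp [L, vecMul_transpose]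

/-- The permutation of `Fin (k + m)` that acts as `σ` on the first `k` and as `τ` on the last `m`
indices. -/
def blockPerm (σ : Equiv.Perm (Fin k)) (τ : Equiv.Perm (Fin m)) : Equiv.Perm (Fin (k + m)) :=
  finSumFinEquiv.permCongr (σ.sumCongr τ)

@[simp] lemma blockPerm_castAdd (σ : Equiv.Perm (Fin k)) (τ : Equiv.Perm (Fin m)) (i : Fin k) :
    blockPerm σ τ (Fin.castAdd m i) = Fin.castAdd m (σ i) := by
  simp [blockPerm]

@[simp] lemma blockPerm_natAdd (σ : Equiv.Perm (Fin k)) (τ : Equiv.Perm (Fin m)) (j : Fin m) :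
    blockPerm σ τ (Fin.natAdd k j) = Fin.natAdd k (τ j) := by
  simp [blockPerm]

lemma monomialEquiv_append (σ : Equiv.Perm (Fin k)) (τ : Equiv.Perm (Fin m))
    (s : Fin k → (ZMod 3)ˣ) (t : Fin m → (ZMod 3)ˣ) (u : Fin k → ZMod 3) (v : Fin m → ZMod 3) :
    monomialEquiv (blockPerm σ τ) (Fin.append s t) (Fin.append u v) =
      Fin.append (monomialEquiv σ s u) (monomialEquiv τ t v) := by
  ext j
  refine Fin.addCases (fun j => ?_) (fun j => ?_) j <;> simp

lemma codeEquiv_sysCode_of_eq {A B : Matrix (Fin k) (Fin m) (ZMod 3)} (ρ : Equiv.Perm (Fin k))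
    (π : Equiv.Perm (Fin m)) (r : Fin k → (ZMod 3)ˣ) (c : Fin m → (ZMod 3)ˣ)
    (hB : ∀ i j, B i j = r i * c j * A (ρ i) (π j)) : CodeEquiv (sysCode A) (sysCode B) := by
  refine codeEquiv_of_forall_monomialEquiv_mem (blockPerm ρ π) (Fin.append r c) ?_
    (by rw [finrank_sysCode, finrank_sysCode])
  intro x hx
  obtain ⟨u, rfl⟩ := mem_sysCode.1 hx
  rw [monomialEquiv_append, append_mem_sysCode]
  ext j
  simp only [monomialEquiv_apply, vecMul, dotProduct, Finset.mul_sum, hB]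
  rw [← Equiv.sum_comp ρ]
  refine Finset.sum_congr rfl fun i _ => ?_
  linear_combination (-(c j * u (ρ i) * A (ρ i) (π j))) * units_mul_self (r i)

lemma map_sysCode_eq_of_rows {A B : Matrix (Fin k) (Fin m) (ZMod 3)}
    {e : TernaryWord (k + m) ≃ₗ[ZMod 3] TernaryWord (k + m)}
    (h : ∀ i, e (sysMatrix A i) ∈ sysCode B) : (sysCode A).map e.toLinearMap = sysCode B := by
  refine Submodule.eq_of_le_of_finrank_eq (Submodule.map_le_iff_le_comap.2 ?_)
    (by rw [LinearEquiv.finrank_map_eq, finrank_sysCode, finrank_sysCode])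
  rw [sysCode, codeOf, Submodule.span_le]
  rintro _ ⟨i, rfl⟩
  exact h i

end SystematicForm

section RowWeights

variable {k m d : ℕ}

lemma hammingNorm_add_le {ι R : Type*} [Fintype ι] [AddGroup R] [DecidableEq R] (x y : ι → R) :
    hammingNorm (x + y) ≤ hammingNorm x + hammingNorm y := by
  simpa [hammingDist_eq_hammingNorm] using hammingDist_triangle (-x) 0 y

lemma hammingNorm_single_le_one {ι R : Type*} [Fintype ι] [DecidableEq ι] [Zero R]
    [DecidableEq R] (i : ι) (a : R) : hammingNorm (Pi.single i a : ι → R) ≤ 1 := by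
  refine Finset.card_le_one.2 fun j hj l hl => ?_
  have mem_single : ∀ j, (Pi.single i a : ι → R) j ≠ 0 → j = i := fun j hj =>
    not_imp_comm.1 (Pi.single_eq_of_ne (M := fun _ => R) · a) hj
  rw [mem_single j (Finset.mem_filter.1 hj).2, mem_single l (Finset.mem_filter.1 hl).2]

lemma hammingNorm_add_add_hammingNorm_sub {ι : Type*} [Fintype ι] {x y : ι → ZMod 3}
    (h : ∀ j, x j = 0 ↔ y j = 0) :
    hammingNorm (x + y) + hammingNorm (x - y) = hammingNorm x := by
  have coordinate : ∀ a b : ZMod 3, (a = 0 ↔ b = 0) →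
      (if a + b ≠ 0 then 1 else 0) + (if a - b ≠ 0 then 1 else 0) = if a ≠ 0 then 1 else 0 := by
    decide
  simp only [hammingNorm, Finset.card_filter, ← Finset.sum_add_distrib]
  exact Finset.sum_congr rfl fun j _ => coordinate _ _ (h j)

variable {A : Matrix (Fin k) (Fin m) (ZMod 3)}

lemma MinWeightGE.le_row (h : MinWeightGE d (sysCode A)) (i : Fin k) :
    d ≤ 1 + hammingNorm (A i) := by
  have hi := minWeightGE_sysCode.1 h (Pi.single i 1) (by simp)
  rw [single_one_vecMul] at hi
  exact hi.trans (Nat.add_le_add_right (hammingNorm_single_le_one i 1) _)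

lemma MinWeightGE.le_add_smul_row (h : MinWeightGE d (sysCode A)) {i j : Fin k} (hij : i ≠ j)
    (a : ZMod 3) : d ≤ 2 + hammingNorm (A i + a • A j) := by
  have hu := minWeightGE_sysCode.1 h (Pi.single i 1 + Pi.single j a) fun h0 => by
    simpa [hij] using congrFun h0 i
  rw [add_vecMul, single_one_vecMul, single_vecMul] at hu
  have h1 := hammingNorm_single_le_one i (1 : ZMod 3)
  have h2 := hammingNorm_single_le_one j a
  have h3 := hammingNorm_add_le (Pi.single i (1 : ZMod 3)) (Pi.single j a)
  exact hu.trans (Nat.add_le_add_right (by omega) _)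

lemma MinWeightGE.le_add_smul_row_add_smul_row (h : MinWeightGE d (sysCode A)) {i j l : Fin k}
    (hij : i ≠ j) (hil : i ≠ l) (a b : ZMod 3) :
    d ≤ 3 + hammingNorm (A i + a • A j + b • A l) := by
  have hu := minWeightGE_sysCode.1 h (Pi.single i 1 + Pi.single j a + Pi.single l b) fun h0 => by
    simpa [hij, hil] using congrFun h0 i
  rw [add_vecMul, add_vecMul, single_one_vecMul, single_vecMul, single_vecMul] at hu
  have h1 := hammingNorm_single_le_one i (1 : ZMod 3)
  have h2 := hammingNorm_single_le_one j a
  have h3 := hammingNorm_single_le_one l b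
  have h4 := hammingNorm_add_le (Pi.single i (1 : ZMod 3)) (Pi.single j a)
  have h5 := hammingNorm_add_le (Pi.single i (1 : ZMod 3) + Pi.single j a) (Pi.single l b)
  exact hu.trans (Nat.add_le_add_right (by omega) _)

/-- If two rows had the same support, then one of their sum and difference would have at most
half the weight of a row. -/
lemma MinWeightGE.eq_of_support_eq (h : MinWeightGE d (sysCode A)) (hd : m + 4 < 2 * d)
    {i j : Fin k} (hij : ∀ l, A i l = 0 ↔ A j l = 0) : i = j := by
  by_contra hne
  have hadd := h.le_add_smul_row hne 1
  have hsub := h.le_add_smul_row hne (-1)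
  have hle : hammingNorm (A i) ≤ m := hammingNorm_le_card_fintype.trans_eq (Fintype.card_fin m)
  rw [one_smul] at hadd
  rw [neg_one_smul, ← sub_eq_add_neg] at hsub
  have := hammingNorm_add_add_hammingNorm_sub hij
  omega

lemma not_minWeightGE_of_finrank_eq {k m : ℕ} (hk : 1 < k) (hm : 2 < m) {C : TernaryCode (k + m)}
    (hC : Module.finrank (ZMod 3) C = k) : ¬ MinWeightGE (m + 1) C := by
  intro h
  obtain ⟨A, hA⟩ := exists_codeEquiv_sysCode hC
  replace h := h.of_codeEquiv hA
  have row_ne_zero : ∀ i j, A i j ≠ 0 := fun i => by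
    have card_le : Fintype.card (Fin m) ≤ hammingNorm (A i) := by
      have := h.le_row i
      rw [Fintype.card_fin]
      omega
    simpa using Finset.filter_card_eq (card_le.antisymm' hammingNorm_le_card_fintype)
  have row_eq : (⟨0, by omega⟩ : Fin k) = ⟨1, hk⟩ := h.eq_of_support_eq (by omega) fun j =>
    iff_of_false (row_ne_zero _ j) (row_ne_zero _ j)
  exact absurd (congrArg Fin.val row_eq) zero_ne_one

end RowWeights

section NormalForm

variable {k m : ℕ}

lemma exists_forall_ne_imp_ne_zero {x : TernaryWord (m + 1)} (hx : m ≤ hammingNorm x) :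
    ∃ z, ∀ j, j ≠ z → x j ≠ 0 := by
  have card_zeros : (Finset.univ.filter (x · = 0)).card ≤ 1 := by
    have := Finset.card_filter_add_card_filter_not (s := Finset.univ) (x · = 0)
    rw [Finset.card_univ, Fintype.card_fin] at this
    simp only [hammingNorm, ne_eq] at hx
    omega
  obtain ⟨z, hz⟩ := Finset.card_le_one_iff_subset_singleton.1 card_zeros
  refine ⟨z, fun j hj h0 => hj ?_⟩
  simpa using hz (Finset.mem_filter.2 ⟨Finset.mem_univ j, h0⟩)

lemma MinWeightGE.exists_zero_columns {A : Matrix (Fin k) (Fin (m + 1)) (ZMod 3)} (hm : 3 < m)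
    (hA : MinWeightGE (m + 1) (sysCode A)) :
    ∃ z : Fin k → Fin (m + 1), (∀ i j, j ≠ z i → A i j ≠ 0) ∧
      Set.InjOn z {i | A i (z i) = 0} ∧ {i | A i (z i) ≠ 0}.Subsingleton := by
  choose z hz using fun i => exists_forall_ne_imp_ne_zero (x := A i) (by
    have := hA.le_row i; omega)
  have eq_of_support : ∀ i i', (∀ j, A i j = 0 ↔ A i' j = 0) → i = i' := fun i i' h =>
    hA.eq_of_support_eq (by omega) h
  have eq_zero_iff : ∀ i j, A i j = 0 ↔ j = z i ∧ A i (z i) = 0 := fun i j => by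
    by_cases hj : j = z i
    · simp [hj]
    · simp [hj, hz i j hj]
  refine ⟨z, hz, fun i hi i' hi' hii' => eq_of_support i i' fun j => ?_,
    fun i hi i' hi' => eq_of_support i i' fun j => ?_⟩
  · rw [eq_zero_iff i, eq_zero_iff i', and_iff_left (show A i (z i) = 0 from hi),
      and_iff_left (show A i' (z i') = 0 from hi'), hii']
  · exact iff_of_false (fun h => hi ((eq_zero_iff i j).1 h).2)
      fun h => hi' ((eq_zero_iff i' j).1 h).2

/-- The permutation `ρ` moves a row without zeros, if there is one, to the end. -/
lemma MinWeightGE.exists_perm_zero_columns (hkm : k ≤ m) (hm : 3 < m)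
    {A : Matrix (Fin (k + 1)) (Fin (m + 1)) (ZMod 3)} (hA : MinWeightGE (m + 1) (sysCode A)) :
    ∃ (ρ : Equiv.Perm (Fin (k + 1))) (z : Fin (k + 1) → Fin (m + 1)), Function.Injective z ∧
      (∀ i : Fin k, A (ρ i.castSucc) (z i.castSucc) = 0) ∧ ∀ i j, j ≠ z i → A (ρ i) j ≠ 0 := by
  obtain ⟨z, hz, z_injOn, hfull⟩ := hA.exists_zero_columns hm
  obtain ⟨ρ, hρ⟩ : ∃ ρ : Equiv.Perm (Fin (k + 1)),
      ∀ i : Fin k, A (ρ i.castSucc) (z (ρ i.castSucc)) = 0 := by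
    by_cases h : ∃ i₀, A i₀ (z i₀) ≠ 0
    · obtain ⟨i₀, hi₀⟩ := h
      refine ⟨Equiv.swap i₀ (Fin.last k), fun i => by_contra fun hi => ?_⟩
      have swap_eq := hfull hi hi₀
      rw [Equiv.swap_apply_eq_iff, Equiv.swap_apply_left] at swap_eq
      exact i.castSucc_ne_last swap_eq
    · push Not at h
      exact ⟨1, fun i => h _⟩
  have z_inj : Function.Injective fun i : Fin k => z (ρ i.castSucc) := fun i i' h =>
    Fin.castSucc_injective k (ρ.injective (z_injOn (hρ i) (hρ i') h))
  obtain ⟨z', hz', hlast⟩ : ∃ z' ∉ Set.range fun i : Fin k => z (ρ i.castSucc),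
      ∀ j, j ≠ z' → A (ρ (Fin.last k)) j ≠ 0 := by
    by_cases h : A (ρ (Fin.last k)) (z (ρ (Fin.last k))) = 0
    · refine ⟨_, ?_, hz _⟩
      rintro ⟨i, hi⟩
      exact i.castSucc_ne_last (ρ.injective (z_injOn (hρ i) h hi))
    · obtain ⟨z', hz'⟩ : ∃ z', z' ∉ Set.range fun i : Fin k => z (ρ i.castSucc) := by
        by_contra! hsurj
        have := Fintype.card_le_of_surjective _ hsurj
        rw [Fintype.card_fin, Fintype.card_fin] at this
        omega
      refine ⟨z', hz', fun j _ => ?_⟩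
      by_cases hj : j = z (ρ (Fin.last k))
      · rwa [hj]
      · exact hz _ j hj
  refine ⟨ρ, Fin.snoc (fun i => z (ρ i.castSucc)) z', Fin.snoc_injective_iff.2 ⟨z_inj, hz'⟩,
    fun i => by simpa using hρ i, Fin.lastCases (by simpa using hlast) fun i => ?_⟩
  simpa using hz _

/-- The possible entries in row `i`, counted from the bottom, and column `j` of a redundancy matrix
in normal form: the last row and the first column consist of ones, except that their common entry
may be zero, and the other zeros are on the antidiagonal. -/
def normalEntries (i j : ℕ) : List (ZMod 3) :=
  if i = j then if i = 0 then [0, 1] else [0] else if i = 0 ∨ j = 0 then [1] else [1, 2]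

lemma exists_unit_mul_eq_one {K : Type*} [Field K] (x : K) : ∃ c : Kˣ, x ≠ 0 → c * x = 1 := by
  by_cases hx : x = 0
  · exact ⟨1, fun h => absurd hx h⟩
  · exact ⟨(Units.mk0 x hx)⁻¹, fun _ => (Units.mk0 x hx).inv_mul⟩

theorem MinWeightGE.exists_codeEquiv_normalForm (hkm : k ≤ m) (hm : 3 < m)
    {A : Matrix (Fin (k + 1)) (Fin (m + 1)) (ZMod 3)} (hA : MinWeightGE (m + 1) (sysCode A)) :
    ∃ B : Matrix (Fin (k + 1)) (Fin (m + 1)) (ZMod 3),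
      CodeEquiv (sysCode A) (sysCode B) ∧
        ∀ (i : Fin (k + 1)) (j : Fin (m + 1)), B i j ∈ normalEntries i.rev j := by
  obtain ⟨ρ, z, z_inj, hzero, hne⟩ := hA.exists_perm_zero_columns hkm hm
  obtain ⟨π, hπ⟩ := Equiv.Perm.exists_extending_pair
    (fun i : Fin (k + 1) => i.rev.castLE (Nat.succ_le_succ hkm)) z
    ((Fin.castLE_injective _).comp Fin.rev_injective) z_inj
  choose c hc using fun j => exists_unit_mul_eq_one (A (ρ (Fin.last k)) (π j))
  choose r hr using fun i => exists_unit_mul_eq_one (c 0 * A (ρ i) (π 0))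
  let s : Fin (k + 1) → (ZMod 3)ˣ := fun i => if i = Fin.last k then 1 else r i
  refine ⟨Matrix.of fun i j => s i * c j * A (ρ i) (π j),
    codeEquiv_sysCode_of_eq ρ π s c fun i j => rfl, fun i j => ?_⟩
  have ne_zero : (i.rev : ℕ) ≠ j → A (ρ i) (π j) ≠ 0 := fun hij =>
    hne i _ fun h => hij (congrArg Fin.val (π.injective (h.trans (hπ i).symm))).symm
  simp only [Matrix.of_apply, normalEntries]
  induction i using Fin.lastCases with
  | last =>
    have one_of_ne : A (ρ (Fin.last k)) (π j) ≠ 0 →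
        s (Fin.last k) * c j * A (ρ (Fin.last k)) (π j) = 1 := fun h => by simp [s, hc j h]
    simp only [Fin.rev_last, Fin.val_zero, if_true, true_or] at ne_zero ⊢
    split_ifs with hj
    · by_cases h : A (ρ (Fin.last k)) (π j) = 0
      · simp [h]
      · simp [one_of_ne h]
    · simp [one_of_ne (ne_zero hj)]
  | cast i =>
    have rev_ne : (i.castSucc.rev : ℕ) ≠ 0 := by simp [Nat.sub_eq_zero_iff_le]
    split_ifs with hij hj
    · have hπj : π j = z i.castSucc := by rw [← hπ]; exact congrArg π (Fin.ext hij.symm)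
      simp [hπj, hzero]
    · obtain rfl : j = 0 := Fin.ext (hj.resolve_left rev_ne)
      have := hr i.castSucc (mul_ne_zero (c 0).ne_zero (ne_zero hij))
      simpa [s, i.castSucc_ne_last, mul_assoc] using this
    · have mem_of_ne_zero : ∀ x : ZMod 3, x ≠ 0 → x ∈ [1, 2] := by decide
      exact mem_of_ne_zero _ (mul_ne_zero (Units.ne_zero (s _ * c j)) (ne_zero hij))

end NormalForm

section Search

variable {α : Type*} {k m n d : ℕ}

/-- The words whose `i`th letter belongs to `X i`. -/
def wordsIn : ∀ {n : ℕ}, (Fin n → List α) → List (Fin n → α)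
  | 0, _ => [![]]
  | _ + 1, X => (X 0).flatMap fun a => (wordsIn (vecTail X)).map (vecCons a)

lemma mem_wordsIn {X : Fin n → List α} {x : Fin n → α} (hx : ∀ i, x i ∈ X i) : x ∈ wordsIn X := by
  induction n with
  | zero => exact List.mem_singleton.2 (Subsingleton.elim _ _)
  | succ n ih =>
    refine List.mem_flatMap.2 ⟨x 0, hx 0, List.mem_map.2 ⟨vecTail x, ih fun i => hx i.succ, ?_⟩⟩
    exact cons_head_tail x

/-- The conditions which the combinations of `r` with at most two rows of `A` impose if
`(I | A')`, where `A'` is `A` with the row `r` put on top, generates a code of minimum weight at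
least `d`. -/
def Compatible (d : ℕ) (r : Fin m → ZMod 3) (A : Fin k → Fin m → ZMod 3) : Prop :=
  (∀ i, ∀ a ∈ [1, 2], d ≤ 2 + hammingNorm (r + (a : ZMod 3) • A i)) ∧
    ∀ i j, i < j → ∀ a ∈ [1, 2], ∀ b ∈ [1, 2],
      d ≤ 3 + hammingNorm (r + (a : ZMod 3) • A i + (b : ZMod 3) • A j)

instance (d : ℕ) (r : Fin m → ZMod 3) (A : Fin k → Fin m → ZMod 3) :
    Decidable (Compatible d r A) := by
  unfold Compatible; infer_instance

/-- Backtracking search for redundancy matrices: the rows are chosen from the given lists, from the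
last one to the first one, and each row has to be compatible with the later ones. -/
def search (d : ℕ) : ∀ {k : ℕ}, (Fin k → List (Fin m → ZMod 3)) →
    List (Matrix (Fin k) (Fin m) (ZMod 3))
  | 0, _ => [![]]
  | _ + 1, X => (search d (vecTail X)).flatMap fun A =>
      ((X 0).filter (Compatible d · A)).map (vecCons · A)

lemma MinWeightGE.vecTail {A : Matrix (Fin (k + 1)) (Fin m) (ZMod 3)}
    (hA : MinWeightGE d (sysCode A)) : MinWeightGE d (sysCode (vecTail A)) := by
  refine minWeightGE_sysCode.2 fun u hu => ?_
  have hcons := minWeightGE_sysCode.1 hA (vecCons 0 u) fun h => hu (cons_eq_zero_iff.1 h).2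
  have norm_cons : hammingNorm (vecCons 0 u) = hammingNorm u := by
    simp [hammingNorm, Finset.card_filter, Fin.sum_univ_succ]
  rwa [show vecCons 0 u ᵥ* A = _ from cons_vecMul 0 u A, zero_smul, zero_add, norm_cons] at hcons

lemma MinWeightGE.compatible {A : Matrix (Fin (k + 1)) (Fin m) (ZMod 3)}
    (hA : MinWeightGE d (sysCode A)) : Compatible d (A 0) (Matrix.vecTail A) :=
  ⟨fun i a _ => hA.le_add_smul_row (Fin.succ_ne_zero i).symm a,
    fun i j _ a _ b _ => hA.le_add_smul_row_add_smul_row (Fin.succ_ne_zero i).symm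
      (Fin.succ_ne_zero j).symm a b⟩

theorem MinWeightGE.mem_search {A : Matrix (Fin k) (Fin m) (ZMod 3)}
    (hA : MinWeightGE d (sysCode A)) {X : Fin k → List (Fin m → ZMod 3)} (hX : ∀ i, A i ∈ X i) :
    A ∈ search d X := by
  induction k with
  | zero => exact List.mem_singleton.2 (Subsingleton.elim _ _)
  | succ k ih =>
    refine List.mem_flatMap.2 ⟨_, ih hA.vecTail fun i => hX i.succ, List.mem_map.2 ⟨A 0, ?_, ?_⟩⟩
    · exact List.mem_filter.2 ⟨hX 0, decide_eq_true hA.compatible⟩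
    · exact cons_head_tail A

end Search

section Uniqueness

/-- The candidates for the rows of a `k × m` matrix in normal form. -/
def normalRows (k m : ℕ) (i : Fin k) : List (Fin m → ZMod 3) :=
  wordsIn fun j => normalEntries i.rev j

variable {k l : ℕ}

/-- Simultaneous permutation of the rows, counted from the bottom, and the first columns, which
preserves the antidiagonal. -/
def relabel (π : Equiv.Perm (Fin k)) (A : Matrix (Fin k) (Fin (k + l)) (ZMod 3)) :
    Matrix (Fin k) (Fin (k + l)) (ZMod 3) :=
  A.submatrix (Fin.revPerm.permCongr π) (blockPerm π 1)

lemma codeEquiv_sysCode_relabel (π : Equiv.Perm (Fin k))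
    (A : Matrix (Fin k) (Fin (k + l)) (ZMod 3)) :
    CodeEquiv (sysCode A) (sysCode (relabel π A)) :=
  codeEquiv_sysCode_of_eq (Fin.revPerm.permCongr π) (blockPerm π 1) 1 1 fun i j => by
    simp [relabel]

/-- The possible redundancy parts in normal form of `[10, 5, 5]` codes, up to `relabel`. -/
def golayCandidate : Fin 2 → Matrix (Fin 5) (Fin 5) (ZMod 3) :=
  ![!![1, 2, 1, 2, 0; 1, 1, 2, 0, 2; 1, 1, 0, 2, 1; 1, 0, 1, 1, 2; 0, 1, 1, 1, 1],
    !![1, 1, 2, 2, 0; 1, 2, 2, 0, 1; 1, 2, 0, 1, 2; 1, 0, 1, 2, 2; 1, 1, 1, 1, 1]]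

/-- The possible redundancy parts in normal form of `[10, 4, 6]` codes, up to `relabel`; such codes
are those of the ten-point ovoids in `PG(3, 3)`. -/
def ovoidCandidate : Fin 2 → Matrix (Fin 4) (Fin 6) (ZMod 3) :=
  ![!![1, 1, 2, 0, 2, 1; 1, 1, 0, 2, 1, 2; 1, 0, 1, 1, 2, 2; 0, 1, 1, 1, 1, 1],
    !![1, 2, 2, 0, 1, 1; 1, 1, 0, 2, 2, 1; 1, 0, 1, 2, 1, 2; 0, 1, 1, 1, 1, 1]]

set_option maxRecDepth 100000 in
lemma exists_relabel_eq_golayCandidate : ∀ A ∈ search 5 (normalRows 5 5),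
    ∃ (π : Equiv.Perm (Fin 5)) (i : Fin 2), relabel (l := 0) π A = golayCandidate i :=
  List.forall_iff_forall_mem.1 <| by decide +kernel

set_option maxRecDepth 100000 in
lemma exists_relabel_eq_ovoidCandidate : ∀ A ∈ search 6 (normalRows 4 6),
    ∃ (π : Equiv.Perm (Fin 4)) (i : Fin 2), relabel (l := 2) π A = ovoidCandidate i :=
  List.forall_iff_forall_mem.1 <| by decide +kernel

lemma codeEquiv_golayCandidate :
    CodeEquiv (sysCode (golayCandidate 1)) (sysCode (golayCandidate 0)) :=
  codeEquiv_iff.2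
    ⟨⟨![0, 1, 2, 9, 4, 8, 6, 5, 7, 3], ![0, 1, 2, 9, 4, 7, 6, 8, 5, 3], by decide, by decide⟩,
      ![1, 1, 1, -1, -1, -1, -1, 1, 1, -1], map_sysCode_eq_of_rows (by decide +kernel)⟩

lemma codeEquiv_ovoidCandidate :
    CodeEquiv (sysCode (ovoidCandidate 1)) (sysCode (ovoidCandidate 0)) :=
  codeEquiv_iff.2
    ⟨⟨![0, 1, 2, 6, 4, 8, 3, 5, 7, 9], ![0, 1, 2, 6, 4, 7, 3, 8, 5, 9], by decide, by decide⟩,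
      ![1, 1, 1, -1, 1, -1, -1, -1, -1, -1], map_sysCode_eq_of_rows (by decide +kernel)⟩

lemma exists_normal_mem_search {k m : ℕ} (hkm : k ≤ m) (hm : 3 < m)
    {C : TernaryCode (k + 1 + (m + 1))}
    (hC : Module.finrank (ZMod 3) C = k + 1) (hd : MinWeightGE (m + 1) C) :
    ∃ A ∈ search (m + 1) (normalRows (k + 1) (m + 1)), CodeEquiv C (sysCode A) := by
  obtain ⟨A, hA⟩ := exists_codeEquiv_sysCode hC
  obtain ⟨B, hB, hentries⟩ := (hd.of_codeEquiv hA).exists_codeEquiv_normalForm hkm hm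
  exact ⟨B, ((hd.of_codeEquiv hA).of_codeEquiv hB).mem_search fun i => mem_wordsIn (hentries i),
    hA.trans hB⟩

lemma codeEquiv_golayCandidate_zero {C : TernaryCode 10} (hC : Module.finrank (ZMod 3) C = 5)
    (hd : MinWeightGE 5 C) : CodeEquiv C (sysCode (golayCandidate 0)) := by
  obtain ⟨A, hA, hCA⟩ := exists_normal_mem_search (k := 4) (m := 4) le_rfl (by decide) hC hd
  obtain ⟨π, i, hi⟩ := exists_relabel_eq_golayCandidate A hA
  have hCi := hCA.trans (codeEquiv_sysCode_relabel (l := 0) π A)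
  rw [hi] at hCi
  fin_cases i
  · exact hCi
  · exact hCi.trans codeEquiv_golayCandidate

lemma codeEquiv_ovoidCandidate_zero {C : TernaryCode 10} (hC : Module.finrank (ZMod 3) C = 4)
    (hd : MinWeightGE 6 C) : CodeEquiv C (sysCode (ovoidCandidate 0)) := by
  obtain ⟨A, hA, hCA⟩ := exists_normal_mem_search (k := 3) (m := 5) (by decide) (by decide) hC hd
  obtain ⟨π, i, hi⟩ := exists_relabel_eq_ovoidCandidate A hA
  have hCi := hCA.trans (codeEquiv_sysCode_relabel (l := 2) π A)
  rw [hi] at hCi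
  fin_cases i
  · exact hCi
  · exact hCi.trans codeEquiv_ovoidCandidate

theorem codeEquiv_of_minWeightGE_five {C D : TernaryCode 10}
    (hC : Module.finrank (ZMod 3) C = 5) (hC' : MinWeightGE 5 C)
    (hD : Module.finrank (ZMod 3) D = 5) (hD' : MinWeightGE 5 D) : CodeEquiv C D :=
  (codeEquiv_golayCandidate_zero hC hC').trans (codeEquiv_golayCandidate_zero hD hD').symm

theorem codeEquiv_of_minWeightGE_six {C D : TernaryCode 10}
    (hC : Module.finrank (ZMod 3) C = 4) (hC' : MinWeightGE 6 C)
    (hD : Module.finrank (ZMod 3) D = 4) (hD' : MinWeightGE 6 D) : CodeEquiv C D :=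
  (codeEquiv_ovoidCandidate_zero hC hC').trans (codeEquiv_ovoidCandidate_zero hD hD').symm

end Uniqueness

section SZEquiv

variable {C C' C'' : TernaryCode (10 + 2)}

@[simp] lemma xPart_append (x : TernaryWord 10) (y : TernaryWord 2) :
    xPart (Fin.append x y) = x :=
  funext fun _ => Fin.append_left ..

@[simp] lemma yPart_append (x : TernaryWord 10) (y : TernaryWord 2) :
    yPart (Fin.append x y) = y :=
  funext fun _ => Fin.append_right ..

lemma append_xPart_yPart (c : TernaryWord (10 + 2)) : Fin.append (xPart c) (yPart c) = c :=
  Fin.append_castAdd_natAdd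

lemma xPart_yPart_ext {c d : TernaryWord (10 + 2)} (hx : xPart c = xPart d)
    (hy : yPart c = yPart d) : c = d := by
  rw [← append_xPart_yPart c, hx, hy, append_xPart_yPart]

lemma xPart_add (c d : TernaryWord (10 + 2)) : xPart (c + d) = xPart c + xPart d := rfl

lemma yPart_add (c d : TernaryWord (10 + 2)) : yPart (c + d) = yPart c + yPart d := rfl

lemma xPart_smul (a : ZMod 3) (c : TernaryWord (10 + 2)) : xPart (a • c) = a • xPart c := rfl

lemma yPart_smul (a : ZMod 3) (c : TernaryWord (10 + 2)) : yPart (a • c) = a • yPart c := rfl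

@[simp] lemma xPart_zero : xPart 0 = 0 := rfl

@[simp] lemma yPart_zero : yPart 0 = 0 := rfl

lemma hammingNorm_eq_add (c : TernaryWord (10 + 2)) :
    hammingNorm c = hammingNorm (xPart c) + hammingNorm (yPart c) := by
  rw [← hammingNorm_append, append_xPart_yPart]

lemma mem_puncture {x : TernaryWord 10} : x ∈ puncture C ↔ ∃ c ∈ C, xPart c = x := Iff.rfl

/-- The maps of SZ-equivalences, with units in place of signs. -/
def szMonomial (σ : Equiv.Perm (Fin 10)) (s : Fin 10 → (ZMod 3)ˣ) (τ : Equiv.Perm (Fin 2))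
    (t : (ZMod 3)ˣ) : TernaryWord (10 + 2) ≃ₗ[ZMod 3] TernaryWord (10 + 2) :=
  monomialEquiv (blockPerm σ τ) (Fin.append s fun _ => t)

section szMonomial

variable (σ : Equiv.Perm (Fin 10)) (s : Fin 10 → (ZMod 3)ˣ) (τ : Equiv.Perm (Fin 2))
  (t : (ZMod 3)ˣ) (c : TernaryWord (10 + 2))

lemma szMonomial_apply : szMonomial σ s τ t c =
    Fin.append (monomialEquiv σ s (xPart c)) (monomialEquiv τ (fun _ => t) (yPart c)) := by
  rw [← monomialEquiv_append, append_xPart_yPart]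
  rfl

@[simp] lemma xPart_szMonomial : xPart (szMonomial σ s τ t c) = monomialEquiv σ s (xPart c) := by
  rw [szMonomial_apply, xPart_append]

@[simp] lemma yPart_szMonomial :
    yPart (szMonomial σ s τ t c) = monomialEquiv τ (fun _ => t) (yPart c) := by
  rw [szMonomial_apply, yPart_append]

end szMonomial

lemma szEquiv_iff : SZEquiv C C' ↔ ∃ σ s τ t, C.map (szMonomial σ s τ t).toLinearMap = C' := by
  have map_eq (σ : Equiv.Perm (Fin 10)) (α : Fin 10 → Fin 2) (τ : Equiv.Perm (Fin 2))
      (β : Fin 2) : szMonomial σ (fun i => (-1) ^ (α i : ℕ)) τ ((-1) ^ (β : ℕ)) =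
        szMap σ α τ β := by
    ext1 c
    rw [szMonomial_apply, szMap]
    congr
  constructor
  · rintro ⟨σ, α, τ, β, h⟩
    refine ⟨σ, fun i => (-1) ^ (α i : ℕ), τ, (-1) ^ (β : ℕ), SetLike.coe_injective ?_⟩
    rw [h, ← map_eq]
    rfl
  · rintro ⟨σ, s, τ, t, rfl⟩
    choose α hα using fun i => exists_sign_eq_unit (s i)
    obtain ⟨β, hβ⟩ := exists_sign_eq_unit t
    refine ⟨σ, α, τ, β, ?_⟩
    rw [← map_eq, show (fun i => (-1) ^ (α i : ℕ)) = s from funext fun i => Units.ext (hα i),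
      show (-1) ^ (β : ℕ) = t from Units.ext hβ]
    rfl

lemma SZEquiv.refl (C : TernaryCode (10 + 2)) : SZEquiv C C := by
  refine szEquiv_iff.2 ⟨1, 1, 1, 1, ?_⟩
  convert Submodule.map_id C
  refine LinearMap.ext fun c => xPart_yPart_ext (funext fun i => ?_) (funext fun j => ?_)
  · exact (congrFun (xPart_szMonomial 1 1 1 1 c) i).trans (one_mul _)
  · exact (congrFun (yPart_szMonomial 1 1 1 1 c) j).trans (one_mul _)

lemma SZEquiv.symm (h : SZEquiv C C') : SZEquiv C' C := by
  obtain ⟨σ, s, τ, t, rfl⟩ := szEquiv_iff.1 h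
  refine szEquiv_iff.2 ⟨σ.symm, fun i => (s (σ.symm i))⁻¹, τ.symm, t⁻¹, ?_⟩
  rw [← Submodule.map_comp]
  convert Submodule.map_id C
  refine LinearMap.ext fun c => xPart_yPart_ext (funext fun i => ?_) (funext fun j => ?_)
  · simp only [LinearMap.comp_apply, LinearEquiv.coe_coe, xPart_szMonomial, monomialEquiv_apply,
      Equiv.apply_symm_apply, Units.inv_mul_cancel_left, LinearMap.id_apply]
  · simp only [LinearMap.comp_apply, LinearEquiv.coe_coe, yPart_szMonomial, monomialEquiv_apply,
      Equiv.apply_symm_apply, Units.inv_mul_cancel_left, LinearMap.id_apply]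

lemma SZEquiv.trans (h : SZEquiv C C') (h' : SZEquiv C' C'') : SZEquiv C C'' := by
  obtain ⟨σ, s, τ, t, rfl⟩ := szEquiv_iff.1 h
  obtain ⟨σ', s', τ', t', rfl⟩ := szEquiv_iff.1 h'
  refine szEquiv_iff.2 ⟨σ'.trans σ, fun i => s' i * s (σ' i), τ'.trans τ, t' * t, ?_⟩
  rw [← Submodule.map_comp]
  congr 1
  refine LinearMap.ext fun c => xPart_yPart_ext (funext fun i => ?_) (funext fun j => ?_)
  · simp only [LinearMap.comp_apply, LinearEquiv.coe_coe, xPart_szMonomial, monomialEquiv_apply,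
      Equiv.trans_apply, Units.val_mul, mul_assoc]
  · simp only [LinearMap.comp_apply, LinearEquiv.coe_coe, yPart_szMonomial, monomialEquiv_apply,
      Equiv.trans_apply, Units.val_mul, mul_assoc]

lemma SZEquiv.codeEquiv_puncture (h : SZEquiv C C') : CodeEquiv (puncture C) (puncture C') := by
  obtain ⟨σ, s, τ, t, rfl⟩ := szEquiv_iff.1 h
  refine codeEquiv_iff.2 ⟨σ, s, ?_⟩
  rw [puncture, puncture, ← Submodule.map_comp, ← Submodule.map_comp]
  exact congrArg (C.map ·) (LinearMap.ext fun c => (xPart_szMonomial σ s τ t c).symm)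

end SZEquiv

section IsotropicCode

/-- Isotropy for the quadratic form `wt x - y₁ y₂`, in dimension five and with minimum weight four
on the first ten coordinates: what is left of (C1)–(C3) in the classification. -/
structure IsIsotropicCode (C : TernaryCode (10 + 2)) : Prop where
  finrank_eq : Module.finrank (ZMod 3) C = 5
  four_le : ∀ c ∈ C, c ≠ 0 → 4 ≤ hammingNorm (xPart c)
  weight_mod : ∀ c ∈ C, (hammingNorm (xPart c) : ZMod 3) = yPart c 0 * yPart c 1

/-- The words of `C` ending in zero, punctured at the last two coordinates. -/
def shortening (C : TernaryCode (10 + 2)) : TernaryCode 10 :=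
  puncture (C ⊓ LinearMap.ker (LinearMap.proj (Fin.natAdd 10 1)))

/-- The extension of `E` by a word `(w, w ⬝ᵥ w, 1)`, where each `x ∈ E` is prolonged to
`(x, -(w ⬝ᵥ x), 0)`, the only possibility in an isotropic code. -/
def isotropicExtension (E : TernaryCode 10) (w : TernaryWord 10) : TernaryCode (10 + 2) where
  carrier := {c | xPart c - yPart c 1 • w ∈ E ∧
    yPart c 0 = -(w ⬝ᵥ xPart c) - yPart c 1 * (w ⬝ᵥ w)}
  add_mem' {c d} hc hd := by
    refine ⟨?_, ?_⟩
    · convert add_mem hc.1 hd.1 using 1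
      simp only [xPart_add, yPart_add, Pi.add_apply]
      module
    · simp only [xPart_add, yPart_add, Pi.add_apply, dotProduct_add, hc.2, hd.2]
      ring
  zero_mem' := by simp [xPart_zero, yPart_zero]
  smul_mem' a c hc := by
    refine ⟨?_, ?_⟩
    · convert E.smul_mem a hc.1 using 1
      simp only [xPart_smul, yPart_smul, Pi.smul_apply, smul_eq_mul]
      module
    · simp only [xPart_smul, yPart_smul, Pi.smul_apply, dotProduct_smul, smul_eq_mul, hc.2]
      ring

variable {C C' : TernaryCode (10 + 2)} {E : TernaryCode 10} {w : TernaryWord 10}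

lemma mem_shortening {x : TernaryWord 10} :
    x ∈ shortening C ↔ ∃ c ∈ C, yPart c 1 = 0 ∧ xPart c = x := by
  simp only [shortening, mem_puncture, Submodule.mem_inf, and_assoc]
  rfl

lemma mem_isotropicExtension {c : TernaryWord (10 + 2)} : c ∈ isotropicExtension E w ↔
    xPart c - yPart c 1 • w ∈ E ∧ yPart c 0 = -(w ⬝ᵥ xPart c) - yPart c 1 * (w ⬝ᵥ w) :=
  Iff.rfl

lemma szEquiv_isotropicExtension_map (σ : Equiv.Perm (Fin 10)) (s : Fin 10 → (ZMod 3)ˣ)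
    (E : TernaryCode 10) (w : TernaryWord 10) : SZEquiv (isotropicExtension E w)
      (isotropicExtension (E.map (monomialEquiv σ s).toLinearMap) (monomialEquiv σ s w)) := by
  have comap_eq : isotropicExtension E w = (isotropicExtension
      (E.map (monomialEquiv σ s).toLinearMap) (monomialEquiv σ s w)).comap
        (szMonomial σ s 1 1).toLinearMap := by
    ext c
    simp only [Submodule.mem_comap, mem_isotropicExtension, LinearEquiv.coe_coe, xPart_szMonomial,
      yPart_szMonomial, monomialEquiv_dotProduct, monomialEquiv_apply (1 : Equiv.Perm (Fin 2)),
      Equiv.Perm.one_apply, Units.val_one, one_mul, ← map_smul, ← map_sub]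
    rw [Submodule.mem_map_equiv, LinearEquiv.symm_apply_apply]
  refine szEquiv_iff.2 ⟨σ, s, 1, 1, ?_⟩
  rw [comap_eq, Submodule.map_comap_eq_of_surjective (szMonomial σ s 1 1).surjective]

lemma isotropicExtension_eq_of_sub_mem (hE : ∀ x ∈ E, ∀ y ∈ E, x ⬝ᵥ y = 0)
    {w' : TernaryWord 10} (hw : w - w' ∈ E) : isotropicExtension E w = isotropicExtension E w' := by
  ext c
  rw [mem_isotropicExtension, mem_isotropicExtension]
  have sub_eq : xPart c - yPart c 1 • w' = xPart c - yPart c 1 • w + yPart c 1 • (w - w') := by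
    module
  rw [sub_eq, E.add_mem_iff_left (E.smul_mem _ hw)]
  refine and_congr_right fun hc => ?_
  have h1 := hE _ hw _ hc
  have h2 := hE _ hw _ hw
  simp only [dotProduct_sub, sub_dotProduct, dotProduct_smul, smul_eq_mul] at h1 h2
  rw [dotProduct_comm w' w] at h1 h2
  have three : (3 : ZMod 3) = 0 := rfl
  have rhs_eq : -(w ⬝ᵥ xPart c) - yPart c 1 * (w ⬝ᵥ w) =
      -(w' ⬝ᵥ xPart c) - yPart c 1 * (w' ⬝ᵥ w') := by
    linear_combination -h1 + yPart c 1 * h2 - yPart c 1 * (w ⬝ᵥ w - w ⬝ᵥ w') * three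
  rw [rhs_eq]

lemma isIsotropicCode_of_szConditions (hC : IsTernaryCode (10 + 2) 5 6 C) (h : SZConditions C) :
    IsIsotropicCode C := by
  refine ⟨hC.1, fun c hc hc0 => ?_, h.weight_mod⟩
  have six_le := hC.minWeightGE c hc hc0
  have y_le : hammingNorm (yPart c) ≤ 2 := hammingNorm_le_card_fintype
  rw [hammingNorm_eq_add] at six_le
  omega

namespace IsIsotropicCode

lemma of_szEquiv (hC : IsIsotropicCode C) (h : SZEquiv C C') : IsIsotropicCode C' := by
  obtain ⟨σ, s, τ, t, rfl⟩ := szEquiv_iff.1 h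
  refine ⟨(LinearEquiv.finrank_map_eq _ C).trans hC.finrank_eq, ?_, ?_⟩ <;>
    rintro _ ⟨c, hc, rfl⟩
  · rw [LinearEquiv.coe_coe, xPart_szMonomial, hammingNorm_monomialEquiv]
    exact fun hc0 => hC.four_le c hc fun h0 => hc0 (by rw [h0, map_zero])
  · have prod_y := Equiv.prod_comp τ (yPart c)
    rw [Fin.prod_univ_two, Fin.prod_univ_two] at prod_y
    simp only [LinearEquiv.coe_coe, xPart_szMonomial, yPart_szMonomial, monomialEquiv_apply,
      hammingNorm_monomialEquiv, hC.weight_mod c hc, mul_mul_mul_comm, units_mul_self, prod_y,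
      one_mul]

lemma eq_zero_of_xPart_eq_zero (hC : IsIsotropicCode C) : ∀ c ∈ C, xPart c = 0 → c = 0 := by
  intro c hc hx
  by_contra hc0
  have := hC.four_le c hc hc0
  rw [hx, hammingNorm_zero] at this
  omega

lemma minWeightGE (hC : IsIsotropicCode C) :
    MinWeightGE 6 C := by
  intro c hc hc0
  have four_le := hC.four_le c hc hc0
  have weight_mod := hC.weight_mod c hc
  rw [hammingNorm_eq_add]
  generalize hammingNorm (xPart c) = a at *
  have weight_y : yPart c 0 * yPart c 1 ≠ 0 → hammingNorm (yPart c) = 2 := by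
    generalize yPart c = y
    revert y; decide
  by_cases hy : yPart c 0 * yPart c 1 = 0
  · have : 3 ∣ a := (ZMod.natCast_eq_zero_iff a 3).1 (weight_mod.trans hy)
    omega
  · have := weight_y hy
    omega

lemma szConditions (hC : IsIsotropicCode C) :
    SZConditions C where
  weight_mod := hC.weight_mod
  three_le c hc hc0 := (Nat.le_succ 3).trans (hC.four_le c hc hc0)
  yPart_ne c hc hcw := by
    have hc0 : c ≠ 0 := by
      rintro rfl
      simp at hcw
    have := hC.four_le c hc hc0
    omega

lemma minWeightGE_shortening (hC : IsIsotropicCode C) : MinWeightGE 6 (shortening C) := by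
  intro x hx hx0
  obtain ⟨c, hc, hy, rfl⟩ := mem_shortening.1 hx
  have four_le := hC.four_le c hc fun h => hx0 (by rw [h, xPart_zero])
  have three_dvd := hC.weight_mod c hc
  rw [hy, mul_zero, ZMod.natCast_eq_zero_iff] at three_dvd
  omega

lemma two_mul_dotProduct (hC : IsIsotropicCode C) {c d : TernaryWord (10 + 2)} (hc : c ∈ C)
    (hd : d ∈ C) :
    2 * (xPart c ⬝ᵥ xPart d) = yPart c 0 * yPart d 1 + yPart c 1 * yPart d 0 := by
  have hcc := hC.weight_mod c hc
  have hdd := hC.weight_mod d hd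
  have hcd := hC.weight_mod (c + d) (C.add_mem hc hd)
  rw [hammingNorm_eq_dotProduct] at hcc hdd hcd
  simp only [xPart_add, yPart_add, add_dotProduct, dotProduct_add, Pi.add_apply,
    dotProduct_comm (xPart d) (xPart c)] at hcd
  linear_combination hcd - hcc - hdd

lemma finrank_puncture (hC : IsIsotropicCode C) {D : TernaryCode (10 + 2)} (hD : D ≤ C) :
    Module.finrank (ZMod 3) (puncture D) = Module.finrank (ZMod 3) D := by
  rw [puncture, ← LinearMap.range_domRestrict]
  refine LinearMap.finrank_range_of_inj ((injective_iff_map_eq_zero _).2 fun c hc => ?_)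
  exact Subtype.ext (hC.eq_zero_of_xPart_eq_zero c (hD c.2) hc)

lemma exists_yPart_one_eq_one (hC : IsIsotropicCode C) : ∃ c ∈ C, yPart c 1 = 1 := by
  by_contra! hy
  have y_eq_zero : ∀ c ∈ C, yPart c 1 = 0 := fun c hc => by
    by_contra hc0
    exact hy _ (C.smul_mem (yPart c 1)⁻¹ hc) (inv_mul_cancel₀ hc0)
  have shortening_eq : shortening C = puncture C := by
    rw [shortening, inf_eq_left.2 y_eq_zero]
  refine not_minWeightGE_of_finrank_eq (k := 5) (m := 5) (by norm_num) (by norm_num) ?_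
    hC.minWeightGE_shortening
  rw [shortening_eq, hC.finrank_puncture le_rfl, hC.finrank_eq]

lemma finrank_shortening (hC : IsIsotropicCode C) :
    Module.finrank (ZMod 3) (shortening C) = 4 := by
  let y : Module.Dual (ZMod 3) (TernaryWord (10 + 2)) := LinearMap.proj (Fin.natAdd 10 1)
  obtain ⟨c, hc, hcy⟩ := hC.exists_yPart_one_eq_one
  have y_ne_zero : y.domRestrict C ≠ 0 := fun h =>
    one_ne_zero (hcy.symm.trans (LinearMap.congr_fun h ⟨c, hc⟩))
  have finrank_ker := Module.Dual.finrank_ker_add_one_of_ne_zero y_ne_zero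
  have map_ker : (LinearMap.ker (y.domRestrict C)).map C.subtype = C ⊓ LinearMap.ker y := by
    rw [LinearMap.ker_domRestrict, Submodule.map_comap_subtype]
  rw [hC.finrank_eq, ← Submodule.finrank_map_subtype_eq, map_ker] at finrank_ker
  rw [shortening, hC.finrank_puncture inf_le_left]
  exact Nat.succ_injective finrank_ker

lemma eq_isotropicExtension (hC : IsIsotropicCode C) {d : TernaryWord (10 + 2)} (hd : d ∈ C)
    (hdy : yPart d 1 = 1) : C = isotropicExtension (shortening C) (xPart d) := by
  have hdd := hC.weight_mod d hd
  rw [hammingNorm_eq_dotProduct, hdy, mul_one] at hdd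
  have three : (3 : ZMod 3) = 0 := rfl
  have y_eq : ∀ c ∈ C, yPart c 0 =
      -(xPart d ⬝ᵥ xPart c) - yPart c 1 * (xPart d ⬝ᵥ xPart d) := fun c hc => by
    have hcd := hC.two_mul_dotProduct hc hd
    rw [hdy, ← hdd, dotProduct_comm] at hcd
    linear_combination -hcd + xPart d ⬝ᵥ xPart c * three
  ext c
  rw [mem_isotropicExtension, mem_shortening]
  constructor
  · intro hc
    exact ⟨⟨c - yPart c 1 • d, C.sub_mem hc (C.smul_mem _ hd),
      (congrArg (yPart c 1 - yPart c 1 * ·) hdy).trans (by ring), rfl⟩, y_eq c hc⟩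
  · rintro ⟨⟨e, he, hey, hex⟩, hcy⟩
    have hc' := C.add_mem he (C.smul_mem (yPart c 1) hd)
    have y_one : yPart (e + yPart c 1 • d) 1 = yPart c 1 :=
      (congrArg₂ (· + yPart c 1 * ·) hey hdy).trans (by ring)
    have x_eq : xPart (e + yPart c 1 • d) = xPart c := by
      rw [xPart_add, hex, xPart_smul, sub_add_cancel]
    have y_zero := y_eq _ hc'
    rw [y_one, x_eq, ← hcy] at y_zero
    rwa [xPart_yPart_ext x_eq (funext (Fin.forall_fin_two.2 ⟨y_zero, y_one⟩))] at hc'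

lemma four_le_hammingNorm_add (h : IsIsotropicCode (isotropicExtension E w)) {x : TernaryWord 10}
    (hx : x ∈ E) : 4 ≤ hammingNorm (x + w) := by
  let c : TernaryWord (10 + 2) := Fin.append (x + w) ![-(w ⬝ᵥ (x + w)) - w ⬝ᵥ w, 1]
  have hc : c ∈ isotropicExtension E w := mem_isotropicExtension.2 (by simpa [c] using hx)
  have hc0 : c ≠ 0 := fun h0 => by simpa [c] using congrArg (yPart · 1) h0
  simpa [c] using h.four_le c hc hc0

end IsIsotropicCode

end IsotropicCode

section GlueWords

lemma dotProduct_eq_zero_of_mem_codeOf {k n : ℕ} {G : Matrix (Fin k) (Fin n) (ZMod 3)}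
    (hG : G * Gᵀ = 0) : ∀ x ∈ codeOf G, ∀ y ∈ codeOf G, x ⬝ᵥ y = 0 := by
  intro x hx y hy
  obtain ⟨u, rfl⟩ := mem_codeOf.1 hx
  obtain ⟨u', rfl⟩ := mem_codeOf.1 hy
  rw [← dotProduct_mulVec, ← mulVec_transpose, mulVec_mulVec, hG, zero_mulVec, dotProduct_zero]

/-- The redundancy part of a self-orthogonal negacyclic `[10, 4, 6]` code. -/
def negacyclicMatrix : Matrix (Fin 4) (Fin 6) (ZMod 3) :=
  !![2, 1, 2, 0, 2, 2; 1, 1, 2, 2, 1, 0; 0, 1, 1, 2, 2, 1; 2, 1, 0, 1, 1, 1]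

/-- The codes of length twelve obtained by gluing a word `w` to the negacyclic code. -/
abbrev negacyclicExtension (w : TernaryWord 10) : TernaryCode (10 + 2) :=
  isotropicExtension (sysCode negacyclicMatrix) w

/-- The left negacyclic shift. -/
def negacyclicShift : TernaryWord (4 + 6) ≃ₗ[ZMod 3] TernaryWord (4 + 6) :=
  monomialEquiv (finRotate 10) fun i => if i = 9 then -1 else 1

/-- An automorphism of the negacyclic code which is not a power of the negacyclic shift. -/
def extraAutomorphism : TernaryWord (4 + 6) ≃ₗ[ZMod 3] TernaryWord (4 + 6) :=
  monomialEquiv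
    ⟨![0, 1, 4, 7, 8, 6, 3, 9, 5, 2], ![0, 1, 9, 6, 2, 8, 5, 3, 4, 7], by decide, by decide⟩
    ![1, -1, -1, -1, 1, 1, 1, 1, 1, 1]

/-- Words `w` representing the equivalence classes of the isotropic codes among the
`negacyclicExtension w`. -/
def glueWord : Fin 3 → TernaryWord (4 + 6) :=
  ![![1, 0, 2, 0, 1, 0, 2, 0, 1, 0], ![1, 1, 2, 2, 1, 1, 2, 2, 1, 1],
    ![0, 0, 0, 0, 0, 1, 0, 2, 1, 2]]

/-- The automorphism of the negacyclic code whose powers bring words to the coset of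
`glueWord j`. -/
def glueSymmetry : Fin 3 → TernaryWord (4 + 6) ≃ₗ[ZMod 3] TernaryWord (4 + 6) :=
  ![negacyclicShift, negacyclicShift, extraAutomorphism]

/-- The action of the negacyclic shift on the syndromes `sysMatrix negacyclicMatrix *ᵥ w`. -/
def syndromeShift : Matrix (Fin 4) (Fin 4) (ZMod 3) :=
  !![1, 1, 0, 0; 0, 0, 1, 0; 2, 0, 0, 1; 2, 0, 0, 0]

/-- Representatives of the orbits of `syndromeShift`. -/
def shiftSyndromes : List (Fin 4 → ZMod 3) :=
  [0, ![1, 0, 0, 0], ![0, 0, 1, 1], ![0, 1, 0, 1], ![0, 1, 0, 2]]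

lemma exists_iterate_mem_shiftSyndromes : ∀ s, ∃ a : Fin 20,
    (syndromeShift *ᵥ ·)^[a] s ∈ shiftSyndromes := by
  decide +kernel

set_option maxRecDepth 100000 in
lemma exists_iterate_sub_glueWord_mem : ∀ v, negacyclicMatrix *ᵥ v ∈ shiftSyndromes →
    (∀ u, 4 ≤ hammingNorm u + hammingNorm (u ᵥ* negacyclicMatrix + v)) →
      ∃ (j : Fin 3) (a : Fin 4),
        (glueSymmetry j)^[a] (Fin.append 0 v) - glueWord j ∈ sysCode negacyclicMatrix := by
  decide +kernel

lemma semiconj_syndrome : Function.Semiconj (sysMatrix negacyclicMatrix *ᵥ ·) negacyclicShift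
    (syndromeShift *ᵥ ·) := by
  have maps_eq : (sysMatrix negacyclicMatrix).mulVecLin ∘ₗ negacyclicShift.toLinearMap =
      syndromeShift.mulVecLin ∘ₗ (sysMatrix negacyclicMatrix).mulVecLin :=
    LinearMap.pi_ext' fun i => LinearMap.ext_ring (by revert i; decide +kernel)
  exact LinearMap.congr_fun maps_eq

lemma map_glueSymmetry (j : Fin 3) :
    (sysCode negacyclicMatrix).map (glueSymmetry j).toLinearMap = sysCode negacyclicMatrix :=
  map_sysCode_eq_of_rows (by revert j; decide +kernel)

lemma exists_glueSymmetry_eq_monomialEquiv (j : Fin 3) :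
    ∃ σ s, glueSymmetry j = monomialEquiv σ s := by
  fin_cases j
  · exact ⟨_, _, rfl⟩
  · exact ⟨_, _, rfl⟩
  · exact ⟨_, _, rfl⟩

lemma szEquiv_glueSymmetry_iterate (j : Fin 3) (a : ℕ) (w : TernaryWord 10) :
    SZEquiv (negacyclicExtension w) (negacyclicExtension ((glueSymmetry j)^[a] w)) := by
  induction a with
  | zero => exact SZEquiv.refl _
  | succ a ih =>
    obtain ⟨σ, s, hj⟩ := exists_glueSymmetry_eq_monomialEquiv j
    have step := szEquiv_isotropicExtension_map σ s (sysCode negacyclicMatrix)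
      ((glueSymmetry j)^[a] w)
    rw [← hj, map_glueSymmetry] at step
    rw [Function.iterate_succ_apply']
    exact ih.trans step

lemma negacyclicExtension_eq {w w' : TernaryWord 10}
    (h : w - w' ∈ sysCode negacyclicMatrix) :
    negacyclicExtension w = negacyclicExtension w' :=
  isotropicExtension_eq_of_sub_mem (dotProduct_eq_zero_of_mem_codeOf (by decide +kernel)) h

lemma syndrome_eq {w : TernaryWord 10} {v : TernaryWord 6}
    (h : w - Fin.append 0 v ∈ sysCode negacyclicMatrix) :
    sysMatrix negacyclicMatrix *ᵥ w = negacyclicMatrix *ᵥ v := by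
  rw [← sysMatrix_mulVec_append_zero negacyclicMatrix, ← sub_eq_zero, ← mulVec_sub]
  ext i
  exact dotProduct_eq_zero_of_mem_codeOf (by decide +kernel) _
    (Submodule.subset_span ⟨i, rfl⟩) _ h

lemma IsIsotropicCode.exists_szEquiv_negacyclicExtension {w : TernaryWord 10}
    (h : IsIsotropicCode (negacyclicExtension w)) :
    ∃ j, SZEquiv (negacyclicExtension w) (negacyclicExtension (glueWord j)) := by
  obtain ⟨a, ha⟩ := exists_iterate_mem_shiftSyndromes (sysMatrix negacyclicMatrix *ᵥ w)
  have syndrome_iterate := semiconj_syndrome.iterate_right a w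
  have shift_equiv := szEquiv_glueSymmetry_iterate 0 a w
  obtain ⟨v, hv⟩ := exists_append_zero_sub_mem_sysCode negacyclicMatrix (negacyclicShift^[a] w)
  rw [← syndrome_iterate, syndrome_eq hv] at ha
  rw [show glueSymmetry 0 = negacyclicShift from rfl, negacyclicExtension_eq hv] at shift_equiv
  obtain ⟨j, b, hj⟩ := exists_iterate_sub_glueWord_mem v ha fun u => by
    have := (h.of_szEquiv shift_equiv).four_le_hammingNorm_add
      (append_mem_sysCode.2 (rfl : u ᵥ* negacyclicMatrix = _))
    rwa [append_add_append, add_zero, hammingNorm_append] at this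
  refine ⟨j, shift_equiv.trans ?_⟩
  rw [← negacyclicExtension_eq hj]
  exact szEquiv_glueSymmetry_iterate j b _

theorem IsIsotropicCode.exists_szEquiv_glueWord {C : TernaryCode (10 + 2)}
    (hC : IsIsotropicCode C) : ∃ j, SZEquiv C (negacyclicExtension (glueWord j)) := by
  obtain ⟨d, hd, hdy⟩ := hC.exists_yPart_one_eq_one
  obtain ⟨σ, s, hE⟩ := codeEquiv_iff.1 (codeEquiv_of_minWeightGE_six hC.finrank_shortening
    hC.minWeightGE_shortening (finrank_sysCode negacyclicMatrix)
    (minWeightGE_sysCode.2 (by decide +kernel)))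
  have to_negacyclic := szEquiv_isotropicExtension_map σ s (shortening C) (xPart d)
  rw [hE, ← hC.eq_isotropicExtension hd hdy] at to_negacyclic
  obtain ⟨j, hj⟩ := (hC.of_szEquiv to_negacyclic).exists_szEquiv_negacyclicExtension
  exact ⟨j, to_negacyclic.trans hj⟩

end GlueWords

section Classification

/-- The redundancy parts of the generator matrices of `C_{10,5}`, `C_{10,4,60}`, `C_{10,4,132}`. -/
def redundancy : Fin 3 → Matrix (Fin 5) (Fin 5) (ZMod 3) :=
  ![!![1, 2, 2, 1, 0; 0, 1, 2, 2, 1; 1, 0, 1, 2, 2; 2, 1, 0, 1, 2; 2, 2, 1, 0, 1],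
    !![0, 0, 1, 1, 1; 0, 1, 0, 1, 1; 1, 0, 1, 0, 1; 1, 1, 0, 0, 1; 1, 2, 2, 1, 0],
    !![0, 0, 1, 1, 1; 0, 1, 0, 1, 1; 1, 0, 1, 0, 1; 1, 1, 0, 0, 1; 1, 1, 1, 1, 1]]

/-- The last two columns of the generator matrices of the codes `code12`. -/
def lastColumns : Fin 3 → Matrix (Fin 5) (Fin 2) (ZMod 3) :=
  ![!![1, 2; 1, 2; 1, 2; 1, 2; 1, 2], !![1, 1; 2, 2; 2, 2; 1, 1; 1, 2],
    !![1, 1; 2, 2; 2, 2; 1, 1; 0, 0]]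

lemma code10_eq (i : Fin 3) : code10 i = sysCode (redundancy i) := by
  fin_cases i <;> rfl

lemma code12_eq (i : Fin 3) :
    code12 i = codeOf (juxtapose (sysMatrix (redundancy i)) (lastColumns i)) := by
  fin_cases i <;> rfl

lemma mem_code12 {i : Fin 3} {c : TernaryWord (10 + 2)} : c ∈ code12 i ↔
    ∃ u, Fin.append (Fin.append u (u ᵥ* redundancy i)) (u ᵥ* lastColumns i) = c := by
  simp only [code12_eq, mem_codeOf, juxtapose, vecMul_of_append, sysMatrix, vecMul_one]

lemma puncture_code12 (i : Fin 3) : puncture (code12 i) = code10 i := by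
  ext x
  rw [mem_puncture, code10_eq, mem_sysCode (k := 5) (m := 5)]
  simp only [mem_code12]
  constructor
  · rintro ⟨_, ⟨u, rfl⟩, rfl⟩
    exact ⟨u, (xPart_append _ _).symm⟩
  · rintro ⟨u, rfl⟩
    exact ⟨_, ⟨u, rfl⟩, xPart_append _ _⟩

lemma minWeightGE_code10 (i : Fin 3) : MinWeightGE (![5, 4, 4] i) (code10 i) := by
  rw [code10_eq]
  exact minWeightGE_sysCode.2 (by revert i; decide +kernel)

lemma isTernaryCode_code10 (i : Fin 3) : IsTernaryCode 10 5 (![5, 4, 4] i) (code10 i) := by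
  obtain ⟨l, weight_row⟩ : ∃ l, hammingNorm (sysMatrix (redundancy i) l) = ![5, 4, 4] i := by
    revert i; decide +kernel
  refine ⟨?_, ⟨_, ?_, ?_, weight_row⟩, ?_⟩
  · rw [code10_eq]
    exact finrank_sysCode (redundancy i)
  · rw [code10_eq]
    exact Submodule.subset_span ⟨l, rfl⟩
  · rw [← hammingNorm_ne_zero_iff, weight_row]
    have ne_zero : ∀ i, ![5, 4, 4] i ≠ 0 := by decide
    exact ne_zero i
  · rintro _ ⟨c, hc, hc0, rfl⟩
    exact minWeightGE_code10 i c hc hc0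

lemma not_codeEquiv_code10_one_two : ¬ CodeEquiv (code10 1) (code10 2) := by
  intro h
  have weight_le : ∀ c ∈ code10 1, hammingNorm c ≤ 9 := by
    intro c hc
    rw [code10_eq, mem_sysCode (k := 5) (m := 5)] at hc
    obtain ⟨u, rfl⟩ := hc
    rw [hammingNorm_append]
    revert u; decide +kernel
  have full_weight_mem : (![1, 1, 1, 2, 2, 2, 2, 1, 1, 1] : TernaryWord 10) ∈ code10 2 := by
    rw [code10_eq, mem_sysCode (k := 5) (m := 5)]
    exact ⟨![1, 1, 1, 2, 2], by decide +kernel⟩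
  obtain ⟨c, hc, hcw⟩ := h.symm.exists_mem_hammingNorm_eq full_weight_mem
  exact absurd (weight_le c hc) (hcw ▸ by decide)

lemma eq_of_codeEquiv_code10 {i j : Fin 3} (h : CodeEquiv (code10 i) (code10 j)) : i = j := by
  have weight_eq := (isTernaryCode_code10 i).eq_of_codeEquiv (isTernaryCode_code10 j) h
  have not_equiv := not_codeEquiv_code10_one_two
  fin_cases i <;> fin_cases j <;> first
    | rfl
    | exact absurd weight_eq (by decide)
    | exact absurd h not_equiv
    | exact absurd h.symm not_equiv

lemma xPart_ne_zero_of_mem_code12 {i : Fin 3} {c : TernaryWord (10 + 2)} (hc : c ∈ code12 i)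
    (hc0 : c ≠ 0) : xPart c ≠ 0 := by
  intro hx
  obtain ⟨u, rfl⟩ := mem_code12.1 hc
  rw [xPart_append, append_eq_zero] at hx
  refine hc0 (append_eq_zero.2 ⟨append_eq_zero.2 hx, ?_⟩)
  rw [hx.1, zero_vecMul]

lemma xPart_mem_code10 {i : Fin 3} {c : TernaryWord (10 + 2)} (hc : c ∈ code12 i) :
    xPart c ∈ code10 i := by
  rw [← puncture_code12]
  exact mem_puncture.2 ⟨c, hc, rfl⟩

lemma finrank_code12 (i : Fin 3) : Module.finrank (ZMod 3) (code12 i) = 5 := by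
  rw [code12_eq]
  refine finrank_codeOf fun u u' h => ?_
  simp only [juxtapose, sysMatrix, vecMul_of_append, vecMul_one, append_inj] at h
  exact h.1.1

lemma isIsotropicCode_code12 (i : Fin 3) : IsIsotropicCode (code12 i) where
  finrank_eq := finrank_code12 i
  four_le c hc hc0 := by
    have four_le : ∀ i, 4 ≤ ![5, 4, 4] i := by decide
    exact (four_le i).trans (minWeightGE_code10 i _ (xPart_mem_code10 hc)
      (xPart_ne_zero_of_mem_code12 hc hc0))
  weight_mod c hc := by
    obtain ⟨u, rfl⟩ := mem_code12.1 hc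
    rw [xPart_append, yPart_append, hammingNorm_append]
    clear hc
    revert i u; decide +kernel

lemma isTernaryCode_code12 (i : Fin 3) : IsTernaryCode (10 + 2) 5 6 (code12 i) := by
  let G := juxtapose (sysMatrix (redundancy i)) (lastColumns i)
  have weight_sub : hammingNorm (G 0 - G 1) = 6 := by
    revert i; decide +kernel
  refine ⟨finrank_code12 i, ⟨G 0 - G 1, ?_, ?_, weight_sub⟩, ?_⟩
  · rw [code12_eq]
    exact sub_mem (Submodule.subset_span ⟨0, rfl⟩) (Submodule.subset_span ⟨1, rfl⟩)
  · rw [← hammingNorm_ne_zero_iff, weight_sub]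
    decide
  · rintro _ ⟨c, hc, hc0, rfl⟩
    exact (isIsotropicCode_code12 i).minWeightGE c hc hc0

/-- Since the codes `code12 i` lie in distinct classes, they represent all three classes of
extensions. -/
theorem IsIsotropicCode.exists_szEquiv_code12 {C : TernaryCode (10 + 2)}
    (hC : IsIsotropicCode C) : ∃ i, SZEquiv C (code12 i) := by
  choose f hf using fun i => (isIsotropicCode_code12 i).exists_szEquiv_glueWord
  have injective_f : Function.Injective f := by
    intro i j hij
    have equiv := (hf i).trans (hij ▸ (hf j).symm)
    refine eq_of_codeEquiv_code10 ?_
    rw [← puncture_code12 i, ← puncture_code12 j]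
    exact equiv.codeEquiv_puncture
  obtain ⟨j, hj⟩ := hC.exists_szEquiv_glueWord
  obtain ⟨i, rfl⟩ := Finite.injective_iff_surjective.1 injective_f j
  exact ⟨i, hj.trans (hf i).symm⟩

end Classification

theorem mainTheorem3 :
    -- the length 10 codes: the unique `[10, 5, 5]` code and two inequivalent `[10, 5, 4]` codes
    IsTernaryCode 10 5 5 (code10 0) ∧
    (∀ D : TernaryCode 10, IsTernaryCode 10 5 5 D → CodeEquiv D (code10 0)) ∧
    IsTernaryCode 10 5 4 (code10 1) ∧
    IsTernaryCode 10 5 4 (code10 2) ∧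
    ¬ CodeEquiv (code10 1) (code10 2) ∧
    -- the three length 12 codes are `[12, 5, 6]` codes with the required properties
    (∀ i : Fin 3, IsTernaryCode (10 + 2) 5 6 (code12 i) ∧ SZConditions (code12 i)) ∧
    -- they are pairwise SZ-inequivalent
    (∀ i j : Fin 3, i ≠ j → ¬ SZEquiv (code12 i) (code12 j)) ∧
    -- every such code is SZ-equivalent to one of them
    (∀ C : TernaryCode (10 + 2), IsTernaryCode (10 + 2) 5 6 C → SZConditions C →
      ∃ i : Fin 3, SZEquiv C (code12 i)) ∧
    -- they arise from the three length 10 codes, one class from each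
    (∀ i : Fin 3, puncture (code12 i) = code10 i) ∧
    (∀ C : TernaryCode (10 + 2), IsTernaryCode (10 + 2) 5 6 C → SZConditions C →
      ∀ i : Fin 3, SZEquiv C (code12 i) ↔ CodeEquiv (puncture C) (code10 i)) := by
  refine ⟨isTernaryCode_code10 0, fun D hD => ?_, isTernaryCode_code10 1, isTernaryCode_code10 2,
    not_codeEquiv_code10_one_two, fun i =>
      ⟨isTernaryCode_code12 i, (isIsotropicCode_code12 i).szConditions⟩,
    fun i j hij h => hij (eq_of_codeEquiv_code10 ?_), fun C hC hS =>
      (isIsotropicCode_of_szConditions hC hS).exists_szEquiv_code12, puncture_code12,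
    fun C hC hS i => ⟨fun h => ?_, fun h => ?_⟩⟩
  · exact codeEquiv_of_minWeightGE_five hD.1 hD.minWeightGE (isTernaryCode_code10 0).1
      (minWeightGE_code10 0)
  · rw [← puncture_code12 i, ← puncture_code12 j]
    exact h.codeEquiv_puncture
  · rw [← puncture_code12 i]
    exact h.codeEquiv_puncture
  · obtain ⟨j, hj⟩ := (isIsotropicCode_of_szConditions hC hS).exists_szEquiv_code12
    have punctures_equiv := hj.codeEquiv_puncture
    rw [puncture_code12] at punctures_equiv
    rwa [← eq_of_codeEquiv_code10 (punctures_equiv.symm.trans h)]
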